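/- Let $KG(n,2)$ be the Kneser graph whose vertices are the $2$-element subsets of $\{1,\dots,n\}$, two vertices being adjacent if and only if they are disjoint. For a positive integer $k$, a fall $k$-coloring of a graph $G$ is a proper coloring $f : V(G)\to\{1,\dots,k\}$ such that for every vertex $v$ all $k$ colors appear on the closed neighborhood of $v$, i.e. $f(N[v])=\{1,\dots,k\}$. Let $\mathrm{Fall}(G)$ be the set of all positive integers $k$ for which $G$ has a fall $k$-coloring. Then for every integer $n\ge 2$, $$\mathrm{Fall}(KG(n,2))=\begin{cases}\{1\} & n=2 \text{ or } 3,\\ \{2\} & n=4,\\ \left\{\frac{n(n-1)}{6}\right\} & n\ge 5,\ n\equiv 1 \text{ or } 3 \pmod 6,\\ \left\{\frac{(n-1)(n-2)}{6}+1\right\} & n\ge 5,\ n\equiv 2 \text{ or } 4 \pmod 6,\\ \emptyset & n\ge 5,\ n\equiv 0 \text{ or } 5 \pmod 6.\end{cases}$$ -/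

import Mathlib

/-- The Kneser graph `KG(n, m)`: the vertices are the `m`-subsets of an `n`-set, and two distinct
vertices are adjacent iff they are disjoint. (Distinctness is automatic for `m ≥ 1`; it only
removes the loop at the empty set when `m = 0`.) -/
def kneserGraph (n m : ℕ) : SimpleGraph {A : Finset (Fin n) // A.card = m} where
  Adj A B := A ≠ B ∧ Disjoint A.1 B.1
  symm := ⟨fun _ _ h => ⟨h.1.symm, h.2.symm⟩⟩
  loopless := ⟨fun _ h => h.1 rfl⟩

/-- The closed neighbourhood `N[v]`. -/
def closedNeighborSet {V : Type*} (G : SimpleGraph V) (v : V) : Set V :=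
  insert v (G.neighborSet v)

/-- A vertex `v` is colorful with respect to a proper coloring `f` if every color appears on
its closed neighbourhood. -/
def IsColorful {V α : Type*} {G : SimpleGraph V} (f : G.Coloring α) (v : V) : Prop :=
  f '' closedNeighborSet G v = Set.univ

/-- A fall coloring is a proper coloring all of whose vertices are colorful. -/
def IsFallColoring {V α : Type*} {G : SimpleGraph V} (f : G.Coloring α) : Prop :=
  ∀ v : V, IsColorful f v

/-- `Fall(G)`: the set of all positive integers `k` for which `G` has a fall `k`-coloring. -/
def Fall {V : Type*} (G : SimpleGraph V) : Set ℕ :=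
  {k | 0 < k ∧ ∃ f : G.Coloring (Fin k), IsFallColoring f}

/-! A color class of a fall coloring is a maximal independent set: properness makes it independent,
and colorfulness makes every vertex outside it adjacent to one inside. In `KG(n,2)` such a set is a
maximal intersecting family of pairs, hence a triangle or a full star (`triangle_or_star`). So a
fall coloring partitions the edges of `K_n` into triangles and stars.

For `n ≥ 4` two stars always share an edge, so at most one occurs. Without a star the partition is a
Steiner triple system on `n` points; with one, deleting its centre leaves such a system on `n - 1`
points. Counting edges, and edges through one vertex, then determines both `n % 6` and `k`.

Conversely, the constructions of Bose and Skolem give Steiner triple systems of all orders needed.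
Coloring a pair by its block, with one extra color for the pairs through a deleted point, is a fall
coloring. The number of colors need not be computed there, since the counting forces it. -/

/-! ### Steiner triple systems as quasigroups: Bose and Skolem -/

/-- The laws of a Steiner quasigroup: idempotent, commutative and left involutive. -/
structure IsSteinerOp {V : Type*} (op : V → V → V) : Prop where
  idem : ∀ x, op x x = x
  comm : ∀ x y, op x y = op y x
  cancel : ∀ x y, op x (op x y) = y

/-- Bose's operation on `Q × ZMod 3`, for an idempotent commutative quasigroup on `Q` with
multiplication `m` and division `d`. -/
def boseOp {Q : Type*} [DecidableEq Q] (m d : Q → Q → Q) (a b : Q × ZMod 3) : Q × ZMod 3 :=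
  if a.2 = b.2 then (if a.1 = b.1 then a else (m a.1 b.1, a.2 + 1))
  else if b.2 = a.2 + 1 then (if b.1 = a.1 then (a.1, a.2 + 2) else (d a.1 b.1, a.2))
  else (if a.1 = b.1 then (b.1, b.2 + 2) else (d b.1 a.1, b.2))

theorem ZMod.three_trichotomy : ∀ i j : ZMod 3, j = i ∨ j = i + 1 ∨ i = j + 1 := by decide

theorem ZMod.three_add : ∀ i : ZMod 3, i + 1 + 1 = i + 2 ∧ i + 1 + 2 = i ∧ i + 2 + 1 = i ∧
    i + 2 + 2 = i + 1 := by decide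

theorem ZMod.three_ne : ∀ i : ZMod 3, i ≠ i + 1 ∧ i ≠ i + 2 ∧ i + 1 ≠ i + 2 ∧
    i + 1 ≠ i ∧ i + 2 ≠ i ∧ i + 2 ≠ i + 1 := by decide

/-- The blocks are `{(x,0), (x,1), (x,2)}` and `{(x,i), (y,i), (m x y, i+1)}` for `x ≠ y`; the
operation returns the third point of a block. -/
theorem isSteinerOp_boseOp {Q : Type*} [DecidableEq Q] (m d : Q → Q → Q)
    (hc : ∀ x y, m x y = m y x) (hi : ∀ x, m x x = x)
    (hmd : ∀ x y, m x (d x y) = y) (hdm : ∀ x y, d x (m x y) = y) :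
    IsSteinerOp (boseOp m d) where
  idem a := by simp [boseOp]
  comm := by
    rintro ⟨x, i⟩ ⟨y, j⟩
    have hi := ZMod.three_ne i
    have hj := ZMod.three_ne j
    have ha := ZMod.three_add i
    have hb := ZMod.three_add j
    rcases ZMod.three_trichotomy i j with rfl | rfl | rfl <;> simp only [boseOp] <;> grind
  cancel := by
    have hdd : ∀ x y, d (d y x) x = y := fun x y => by
      have := hdm (d y x) y; rwa [hc, hmd] at this
    rintro ⟨x, i⟩ ⟨y, j⟩
    rcases ZMod.three_trichotomy i j with rfl | rfl | rfl
    · by_cases h : x = y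
      · simp [boseOp, h]
      · have : m x y ≠ x := fun e => h (by
          exact (hdm x x).symm.trans ((congrArg (d x) ((hi x).trans e.symm)).trans (hdm x y)))
        simp [boseOp, h, this, hdm]
    · by_cases h : y = x
      · simp [boseOp, h, ZMod.three_ne i, ZMod.three_add]
      · have : x ≠ d x y := fun e => h (by rw [← hmd x y, ← e, hi])
        simp [boseOp, h, this, hmd]
    · by_cases h : x = y
      · simp [boseOp, h, ZMod.three_ne j, ZMod.three_add]
      · have : x ≠ d y x := fun e => h (by
          have h1 := hdd x y
          have h2 := hdm x x
          rw [← e] at h1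
          rw [hi] at h2
          exact h2.symm.trans h1)
        simp [boseOp, h, this, hdd, ZMod.three_ne j, ZMod.three_add]

/-- Skolem's operation on `Q × ZMod 3` with a point at infinity, for a commutative quasigroup on
`Q` with multiplication `m` and division `d`, whose idempotents are the elements satisfying `p`
and are exchanged with the other elements by `h`. -/
def skolemOp {Q : Type*} [DecidableEq Q] (m d : Q → Q → Q) (p : Q → Prop) [DecidablePred p]
    (h : Q → Q) : Option (Q × ZMod 3) → Option (Q × ZMod 3) → Option (Q × ZMod 3)
  | none, none => none
  | none, some b => if p b.1 then some (h b.1, b.2 + 2) else some (h b.1, b.2 + 1)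
  | some a, none => if p a.1 then some (h a.1, a.2 + 2) else some (h a.1, a.2 + 1)
  | some a, some b =>
    if a.2 = b.2 then (if a.1 = b.1 then some a else some (m a.1 b.1, a.2 + 1))
    else if b.2 = a.2 + 1 then
      (if b.1 = m a.1 a.1 then (if p a.1 then some (a.1, a.2 + 2) else none)
        else some (d a.1 b.1, a.2))
    else
      (if a.1 = m b.1 b.1 then (if p b.1 then some (b.1, b.2 + 2) else none)
        else some (d b.1 a.1, b.2))

/-- The blocks are `{(x,0), (x,1), (x,2)}` for `p x`, `{∞, (x,i), (h x, i+1)}` for `¬ p x`, and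
`{(x,i), (y,i), (m x y, i+1)}` for `x ≠ y`. -/
theorem isSteinerOp_skolemOp {Q : Type*} [DecidableEq Q] (m d : Q → Q → Q) (p : Q → Prop)
    [DecidablePred p] (h : Q → Q)
    (hc : ∀ x y, m x y = m y x)
    (hmd : ∀ x y, m x (d x y) = y) (hdm : ∀ x y, d x (m x y) = y)
    (hp : ∀ x, p x → m x x = x) (hnp : ∀ x, ¬ p x → m x x = h x)
    (hh : ∀ x, h (h x) = x) (hph : ∀ x, p (h x) ↔ ¬ p x) :
    IsSteinerOp (skolemOp m d p h) where
  idem := by rintro (_ | a) <;> simp [skolemOp]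
  comm := by
    rintro (_ | ⟨x, i⟩) (_ | ⟨y, j⟩)
    · rfl
    · rfl
    · rfl
    have hi := ZMod.three_ne i
    have hj := ZMod.three_ne j
    have ha := ZMod.three_add i
    have hb := ZMod.three_add j
    rcases ZMod.three_trichotomy i j with rfl | rfl | rfl <;> simp only [skolemOp] <;> grind
  cancel := by
    have hdd : ∀ x y, d (d y x) x = y := fun x y => by
      have := hdm (d y x) y; rwa [hc, hmd] at this
    rintro (_ | ⟨x, i⟩) (_ | ⟨y, j⟩)
    · rfl
    · by_cases h1 : p y <;> simp [skolemOp, hph, hh, h1, ZMod.three_add]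
    · by_cases h1 : p x
      · have h3 : x = m (h x) (h x) := by rw [hnp _ (by simpa [hph] using h1), hh]
        simp [skolemOp, h1, ← h3, hph, ZMod.three_ne i]
      · simp [skolemOp, h1, hnp]
    rcases ZMod.three_trichotomy i j with rfl | rfl | rfl
    · by_cases h : x = y
      · simp [skolemOp, h]
      · have : m x y ≠ m x x := fun e => h (by rw [← hdm x y, e, hdm])
        simp [skolemOp, h, this, hdm]
    · by_cases h : y = m x x
      · by_cases h' : p x
        · simp [skolemOp, h, h', hp, ZMod.three_ne i, ZMod.three_add]
        · simp [skolemOp, h, h', hnp]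
      · have : x ≠ d x y := fun e => h (by conv_lhs => rw [← hmd x y, ← e])
        simp [skolemOp, h, this, hmd]
    · by_cases h : x = m y y
      · by_cases h' : p y
        · simp [skolemOp, h, h', hp, ZMod.three_ne j, ZMod.three_add]
        · simp [skolemOp, h, h', hnp, hh, hph, ZMod.three_ne j, ZMod.three_add]
      · have h6 : x ≠ m (d y x) (d y x) := fun e => h (by
          have h1 := hdm (d y x) (d y x)
          rw [← e, hdd] at h1
          rwa [← h1] at e)
        simp [skolemOp, h, h6, hdd, ZMod.three_ne j, ZMod.three_add]

theorem exists_steinerOp_bose (t : ℕ) :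
    ∃ op : ZMod (2 * t + 1) × ZMod 3 → ZMod (2 * t + 1) × ZMod 3 → ZMod (2 * t + 1) × ZMod 3,
      IsSteinerOp op := by
  -- Since `t + 1` inverts `2`, the mean `(x + y) / 2` is an idempotent commutative quasigroup.
  have h2 : (2 : ZMod (2 * t + 1)) * (t + 1) = 1 := by
    have : ((2 * t + 1 : ℕ) : ZMod (2 * t + 1)) = 0 := ZMod.natCast_self _
    push_cast at this
    linear_combination this
  refine ⟨boseOp (fun x y => (x + y) * (t + 1)) (fun x y => 2 * y - x),
    isSteinerOp_boseOp _ _ ?_ ?_ ?_ ?_⟩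
  · intro x y; ring
  · intro x; linear_combination x * h2
  · intro x y; linear_combination y * h2
  · intro x y; linear_combination (x + y) * h2

theorem exists_steinerOp_skolem (t : ℕ) (ht : 0 < t) :
    ∃ op : Option (Fin (2 * t) × ZMod 3) → Option (Fin (2 * t) × ZMod 3) →
      Option (Fin (2 * t) × ZMod 3), IsSteinerOp op := by
  have : NeZero (2 * t) := ⟨by omega⟩
  -- In the cyclic group of order `2t` the doubles are the even residues, each hit by `x` and `x +
  -- t`. Relabelling `2j` as `j` and `2j + 1` as `j + t` makes `x < t` idempotent and sends the
  -- square of `x ≥ t` to `x - t`.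
  let σ : Fin (2 * t) ≃ Fin (2 * t) :=
    { toFun := fun v => ⟨if v.1 % 2 = 0 then v.1 / 2 else v.1 / 2 + t, by
        have := v.2; split_ifs <;> omega⟩
      invFun := fun w => ⟨if w.1 < t then 2 * w.1 else 2 * (w.1 - t) + 1, by
        have := w.2; split_ifs <;> omega⟩
      left_inv := fun v => by
        have := v.2
        ext; simp only; split_ifs <;> omega
      right_inv := fun w => by
        have := w.2
        ext; simp only; split_ifs <;> omega }
  let h : Fin (2 * t) → Fin (2 * t) := fun x =>
    ⟨if x.1 < t then x.1 + t else x.1 - t, by have := x.2; split_ifs <;> omega⟩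
  have hadd : ∀ x : Fin (2 * t), (x + x).1 = if x.1 < t then 2 * x.1 else 2 * (x.1 - t) := by
    intro x
    have := x.2
    rw [Fin.val_add]
    split_ifs with hx
    · rw [Nat.mod_eq_of_lt (by omega)]; omega
    · rw [Nat.mod_eq_sub_mod (by omega), Nat.mod_eq_of_lt (by omega)]; omega
  refine ⟨skolemOp (fun x y => σ (x + y)) (fun x y => σ.symm y - x) (fun x => x.1 < t) h,
    isSteinerOp_skolemOp _ _ _ _ ?_ ?_ ?_ ?_ ?_ ?_ ?_⟩
  · intro x y; simp only [add_comm]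
  · intro x y; simp
  · intro x y; simp
  · intro x hx
    ext
    simp only [σ, Equiv.coe_fn_mk, hadd, hx, if_true]
    split_ifs <;> omega
  · intro x hx
    ext
    simp only [σ, h, Equiv.coe_fn_mk, hadd, hx, if_false]
    split_ifs <;> omega
  · intro x
    have := x.2
    ext; simp only [h]; split_ifs <;> omega
  · intro x
    have := x.2
    simp only [h]; split_ifs <;> omega

/-! ### Color classes and edge counting -/

theorem card_filter_mem_powersetCard_two {X : Type*} [DecidableEq X] (T : Finset X) (a : X) :
    ((T.powersetCard 2).filter (a ∈ ·)).card = if a ∈ T then T.card - 1 else 0 := by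
  split_ifs with ha
  · rw [← Finset.card_erase_of_mem ha]
    symm
    refine Finset.card_bij (fun x _ => {a, x}) ?_ ?_ ?_
    · intro x hx
      simp only [Finset.mem_erase] at hx
      simp only [Finset.mem_filter, Finset.mem_powersetCard]
      refine ⟨⟨?_, Finset.card_pair (Ne.symm hx.1)⟩, by simp⟩
      intro y; simp only [Finset.mem_insert, Finset.mem_singleton]
      rintro (rfl | rfl); exacts [ha, hx.2]
    · intro x hx y hy h
      have : x ∈ ({a, y} : Finset X) := h ▸ (by simp)
      simp only [Finset.mem_erase, Finset.mem_insert, Finset.mem_singleton] at *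
      tauto
    · intro A hA
      simp only [Finset.mem_filter, Finset.mem_powersetCard] at hA
      obtain ⟨⟨h1, h2⟩, h3⟩ := hA
      obtain ⟨x, hx⟩ := Finset.card_eq_one.1 (show (A.erase a).card = 1 by
        rw [Finset.card_erase_of_mem h3, h2])
      have hxA : x ∈ A.erase a := by simp [hx]
      simp only [Finset.mem_erase] at hxA
      refine ⟨x, by simp [hxA.1, h1 hxA.2], ?_⟩
      rw [← hx, Finset.insert_erase h3]
  · rw [Finset.card_eq_zero, Finset.filter_eq_empty_iff]
    intro A hA haA
    exact ha ((Finset.mem_powersetCard.1 hA).1 haA)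

/-- A maximal intersecting family of pairs is a triangle or a full star. -/
theorem triangle_or_star {X : Type*} [DecidableEq X] [Fintype X] (S : Finset (Finset X))
    (hcard : ∀ A ∈ S, A.card = 2) (hne : S.Nonempty)
    (hint : ∀ A ∈ S, ∀ B ∈ S, ¬ Disjoint A B)
    (hmax : ∀ A, A.card = 2 → (∀ B ∈ S, ¬ Disjoint A B) → A ∈ S) :
    (∃ T : Finset X, T.card = 3 ∧ S = T.powersetCard 2) ∨
      ∃ a, S = ((Finset.univ : Finset X).powersetCard 2).filter (a ∈ ·) := by
  have hstar : ∀ a, (∀ A ∈ S, a ∈ A) →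
      S = ((Finset.univ : Finset X).powersetCard 2).filter (a ∈ ·) := by
    intro a ha
    ext A
    simp only [Finset.mem_filter, Finset.mem_powersetCard, Finset.subset_univ, true_and]
    refine ⟨fun h => ⟨hcard A h, ha A h⟩, fun h => hmax A h.1 fun B hB => ?_⟩
    exact Finset.not_disjoint_iff.2 ⟨a, h.2, ha B hB⟩
  obtain ⟨E, hE⟩ := hne
  obtain ⟨a, b, hab, rfl⟩ := Finset.card_eq_two.1 (hcard E hE)
  by_cases ha : ∀ A ∈ S, a ∈ A
  · exact .inr ⟨a, hstar a ha⟩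
  by_cases hb : ∀ A ∈ S, b ∈ A
  · exact .inr ⟨b, hstar b hb⟩
  -- A member avoiding `a` must contain `b`, and one avoiding `b` must contain `a`; the two meet in
  -- a third point `c`, which gives a triangle.
  push Not at ha hb
  obtain ⟨A, hA, haA⟩ := ha
  obtain ⟨B, hB, hbB⟩ := hb
  have hA2 := hcard A hA
  have hB2 := hcard B hB
  have h1 := hint _ hE A hA
  have h2 := hint _ hE B hB
  have h3 := hint A hA B hB
  have hbA : b ∈ A := by by_contra h; exact h1 (by simp [haA, h])
  have haB : a ∈ B := by by_contra h; exact h2 (by simp [hbB, h])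
  obtain ⟨c, hcA, hcB⟩ := Finset.not_disjoint_iff.1 h3
  have hca : c ≠ a := by rintro rfl; exact haA hcA
  have hcb : c ≠ b := by rintro rfl; exact hbB hcB
  have hAe : {b, c} = A := Finset.eq_of_subset_of_card_le
    (by simp [Finset.insert_subset_iff, *]) (by rw [hA2, Finset.card_pair hcb.symm])
  have hBe : {a, c} = B := Finset.eq_of_subset_of_card_le
    (by simp [Finset.insert_subset_iff, *]) (by rw [hB2, Finset.card_pair hca.symm])
  subst hAe hBe
  refine .inl ⟨{a, b, c}, Finset.card_eq_three.2 ⟨a, b, c, hab, hca.symm, hcb.symm, rfl⟩, ?_⟩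
  ext D
  rw [Finset.mem_powersetCard]
  constructor
  · intro hD
    have e1 := hint _ hE D hD
    have e2 := hint _ hA D hD
    have e3 := hint _ hB D hD
    obtain ⟨x, y, hxy, rfl⟩ := Finset.card_eq_two.1 (hcard D hD)
    refine ⟨?_, Finset.card_pair hxy⟩
    simp only [Finset.disjoint_left] at e1 e2 e3
    simp only [Finset.insert_subset_iff]
    grind
  · rintro ⟨hD, hD2⟩
    obtain ⟨x, y, hxy, rfl⟩ := Finset.card_eq_two.1 hD2
    simp only [Finset.insert_subset_iff, Finset.singleton_subset_iff, Finset.mem_insert,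
      Finset.mem_singleton] at hD
    have : ({x, y} : Finset X) = {a, b} ∨ ({x, y} : Finset X) = {b, c} ∨
        ({x, y} : Finset X) = {a, c} := by
      obtain ⟨rfl | rfl | rfl, rfl | rfl | rfl⟩ := hD <;> simp_all [Finset.pair_comm]
    rcases this with h | h | h <;> rwa [h]

/-- Triangles contribute `3` edges in total and an even number at each vertex. These two counts give
the conditions modulo `3` and modulo `2`, after the star, if any, is set aside. -/
theorem mod_six_of_decomposition {n k : ℕ} (hn : 4 ≤ n)
    (S : Fin k → Finset (Finset (Fin n)))
    (hS : ∀ i, (∃ T : Finset (Fin n), T.card = 3 ∧ S i = T.powersetCard 2) ∨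
      ∃ a, S i = ((Finset.univ : Finset (Fin n)).powersetCard 2).filter (a ∈ ·))
    (hpart : ∀ A : Finset (Fin n), A.card = 2 → ∃! i, A ∈ S i) :
    ((n % 6 = 1 ∨ n % 6 = 3) ∧ k = n * (n - 1) / 6) ∨
      ((n % 6 = 2 ∨ n % 6 = 4) ∧ k = (n - 1) * (n - 2) / 6 + 1) := by
  classical
  have hsub : ∀ i, ∀ A ∈ S i, A.card = 2 := by
    intro i A hA
    rcases hS i with ⟨T, -, h⟩ | ⟨a, h⟩ <;> rw [h] at hA <;>
      simp only [Finset.mem_filter, Finset.mem_powersetCard] at hA <;> tauto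
  have hdisj : ∀ i j, i ≠ j → Disjoint (S i) (S j) := by
    intro i j hij
    rw [Finset.disjoint_left]
    intro A hi hj
    exact hij ((hpart A (hsub i A hi)).unique hi hj)
  have hU : (Finset.univ : Finset (Fin n)).powersetCard 2 = Finset.univ.biUnion S := by
    ext A
    simp only [Finset.mem_powersetCard, Finset.subset_univ, true_and, Finset.mem_biUnion,
      Finset.mem_univ]
    exact ⟨fun h => (hpart A h).exists, fun ⟨i, hi⟩ => hsub i A hi⟩
  have htot : n.choose 2 = ∑ i, (S i).card := by
    rw [← Finset.card_biUnion fun i _ j _ h => hdisj i j h, ← hU]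
    simp
  have hdeg : ∀ a : Fin n, n - 1 = ∑ i, ((S i).filter (a ∈ ·)).card := by
    intro a
    rw [← Finset.card_biUnion fun i _ j _ h =>
      Finset.disjoint_filter_filter (hdisj i j h), ← Finset.filter_biUnion, ← hU,
      card_filter_mem_powersetCard_two]
    simp
  have htri : ∀ T : Finset (Fin n), T.card = 3 → (T.powersetCard 2).card = 3 := by
    intro T hT; rw [Finset.card_powersetCard, hT]; rfl
  have htri2 : ∀ T : Finset (Fin n), ∀ a, T.card = 3 →
      2 ∣ ((T.powersetCard 2).filter (a ∈ ·)).card := by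
    intro T a hT; rw [card_filter_mem_powersetCard_two, hT]; split_ifs <;> simp
  have hch : n.choose 2 * 2 = n * (n - 1) := by
    rw [Nat.choose_two_right]
    exact Nat.div_mul_cancel (Nat.even_mul_pred_self n).two_dvd
  by_cases hall : ∀ i, ∃ T : Finset (Fin n), T.card = 3 ∧ S i = T.powersetCard 2
  · have h3 : n.choose 2 = k * 3 := by
      rw [htot, Finset.sum_congr rfl (g := fun _ => 3)]
      · simp
      · intro i _; obtain ⟨T, hT, h⟩ := hall i; rw [h, htri T hT]
    have h2 : 2 ∣ n - 1 := by
      rw [hdeg ⟨0, by omega⟩]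
      refine Finset.dvd_sum fun i _ => ?_
      obtain ⟨T, hT, h⟩ := hall i; rw [h]; exact htri2 T _ hT
    have h6 : n * (n - 1) = 6 * k := by omega
    left
    refine ⟨?_, by omega⟩
    have h7 : (n * (n - 1)) % 3 = 0 := by omega
    rcases (Nat.prime_three.dvd_mul).1 (Nat.dvd_of_mod_eq_zero h7) with h | h <;> omega
  · push Not at hall
    obtain ⟨i₀, hi₀⟩ := hall
    obtain ⟨a, ha⟩ : ∃ a, S i₀ =
        ((Finset.univ : Finset (Fin n)).powersetCard 2).filter (a ∈ ·) := by
      rcases hS i₀ with ⟨T, hT, h⟩ | h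
      · exact absurd h (hi₀ T hT)
      · exact h
    have hoth : ∀ i, i ≠ i₀ → ∃ T : Finset (Fin n), T.card = 3 ∧ S i = T.powersetCard 2 := by
      intro i hi
      rcases hS i with h | ⟨b, hb⟩
      · exact h
      exfalso
      -- Two stars with distinct centres share `{a, b}`; with a common centre they share `{a, c}`.
      obtain ⟨c, hc⟩ : ∃ c, c ∉ ({a, b} : Finset (Fin n)) := by
        by_contra! h
        have := Finset.card_le_card (fun x _ => h x : Finset.univ ⊆ ({a, b} : Finset (Fin n)))
        have := Finset.card_le_two (a := a) (b := b)
        simp at *; omega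
      simp only [Finset.mem_insert, Finset.mem_singleton, not_or] at hc
      by_cases hab : a = b
      · subst hab
        refine hi ((hpart {a, c} (Finset.card_pair (Ne.symm hc.1))).unique ?_ ?_)
        · rw [hb]; simp [Finset.card_pair (Ne.symm hc.1)]
        · rw [ha]; simp [Finset.card_pair (Ne.symm hc.1)]
      · refine hi ((hpart {a, b} (Finset.card_pair hab)).unique ?_ ?_)
        · rw [hb]; simp [Finset.card_pair hab]
        · rw [ha]; simp [Finset.card_pair hab]
    have hstar : (S i₀).card = n - 1 := by
      rw [ha, card_filter_mem_powersetCard_two]; simp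
    have hk : (Finset.univ.erase i₀).card = k - 1 := by simp
    have hkpos : 0 < k := i₀.pos
    have h3 : n.choose 2 = (n - 1) + (k - 1) * 3 := by
      rw [htot, ← Finset.add_sum_erase _ _ (Finset.mem_univ i₀), hstar,
        Finset.sum_congr rfl (g := fun _ => 3)]
      · simp
      · intro i hi; obtain ⟨T, hT, h⟩ := hoth i (Finset.ne_of_mem_erase hi); rw [h, htri T hT]
    obtain ⟨b, hb⟩ : ∃ b, b ≠ a := by
      have : Nontrivial (Fin n) := Fin.nontrivial_iff_two_le.2 (by omega)
      exact exists_ne a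
    -- Only `{a, b}` in the star passes through `b`, so triangles cover the other `n - 2` edges at
    -- `b`.
    have hone : ((S i₀).filter (b ∈ ·)).card = 1 := by
      rw [Finset.card_eq_one]
      refine ⟨{a, b}, ?_⟩
      rw [ha]
      ext A
      simp only [Finset.mem_filter, Finset.mem_powersetCard, Finset.subset_univ, true_and,
        Finset.mem_singleton]
      constructor
      · rintro ⟨⟨h1, h2⟩, h3⟩
        refine (Finset.eq_of_subset_of_card_le ?_ (by rw [h1, Finset.card_pair hb.symm])).symm
        simp [Finset.insert_subset_iff, *]
      · rintro rfl; simp [Finset.card_pair hb.symm]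
    have h2 : 2 ∣ n - 2 := by
      have : n - 2 = ∑ i ∈ Finset.univ.erase i₀, ((S i).filter (b ∈ ·)).card := by
        have := hdeg b
        rw [← Finset.add_sum_erase _ _ (Finset.mem_univ i₀), hone] at this
        omega
      rw [this]
      refine Finset.dvd_sum fun i hi => ?_
      obtain ⟨T, hT, h⟩ := hoth i (Finset.ne_of_mem_erase hi); rw [h]; exact htri2 T _ hT
    obtain ⟨j, rfl⟩ : ∃ j, k = j + 1 := ⟨k - 1, by omega⟩
    obtain ⟨m, rfl⟩ : ∃ m, n = m + 2 := ⟨n - 2, by omega⟩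
    have h6 : (m + 1) * m = 6 * j := by
      simp only [Nat.add_sub_cancel] at *
      have e : m + 2 - 1 = m + 1 := by omega
      rw [e] at hch h3
      nlinarith
    right
    have e : m + 2 - 1 = m + 1 := by omega
    rw [e, Nat.add_sub_cancel, h6]
    refine ⟨?_, by omega⟩
    have h7 : ((m + 1) * m) % 3 = 0 := by omega
    rcases (Nat.prime_three.dvd_mul).1 (Nat.dvd_of_mod_eq_zero h7) with h | h <;> omega

theorem mod_six_of_mem_Fall {n k : ℕ} (hn : 4 ≤ n) (hk : k ∈ Fall (kneserGraph n 2)) :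
    ((n % 6 = 1 ∨ n % 6 = 3) ∧ k = n * (n - 1) / 6) ∨
      ((n % 6 = 2 ∨ n % 6 = 4) ∧ k = (n - 1) * (n - 2) / 6 + 1) := by
  classical
  obtain ⟨-, f, hf⟩ := hk
  have hcol : ∀ v i, ∃ u, (u = v ∨ (kneserGraph n 2).Adj v u) ∧ f u = i := by
    intro v i
    have : i ∈ f '' closedNeighborSet (kneserGraph n 2) v := by rw [hf v]; trivial
    obtain ⟨u, hu, h⟩ := this
    exact ⟨u, hu, h⟩
  let S : Fin k → Finset (Finset (Fin n)) := fun i =>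
    (Finset.univ.filter (f · = i)).map (Function.Embedding.subtype _)
  have hmem : ∀ i A, A ∈ S i ↔ ∃ h : A.card = 2, f ⟨A, h⟩ = i := by
    intro i A; simp [S]
  refine mod_six_of_decomposition hn S (fun i => ?_) ?_
  · refine triangle_or_star (S i) ?_ ?_ ?_ ?_
    · intro A hA; exact ((hmem i A).1 hA).1
    · obtain ⟨u, -, hu⟩ := hcol
        ⟨{(⟨0, by omega⟩ : Fin n), (⟨1, by omega⟩ : Fin n)}, Finset.card_pair (by simp)⟩ i
      exact ⟨u.1, (hmem _ _).2 ⟨u.2, hu⟩⟩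
    · intro A hA B hB hd
      obtain ⟨hA2, hfA⟩ := (hmem _ _).1 hA
      obtain ⟨hB2, hfB⟩ := (hmem _ _).1 hB
      refine f.valid (v := ⟨A, hA2⟩) (w := ⟨B, hB2⟩) ⟨?_, hd⟩ (hfA.trans hfB.symm)
      intro h
      obtain rfl := congrArg Subtype.val h
      rw [disjoint_self] at hd
      simp [hd] at hA2
    -- Maximality is colorfulness at `A`: a vertex of color `i` in its closed neighborhood cannot be
    -- disjoint from `A`, so it is `A`.
    · intro A hA2 hA
      obtain ⟨u, hu | hu, hfu⟩ := hcol ⟨A, hA2⟩ i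
      · exact (hmem _ _).2 ⟨hA2, hu ▸ hfu⟩
      · exact absurd hu.2 (hA u.1 ((hmem _ _).2 ⟨u.2, hfu⟩))
  · intro A hA
    exact ⟨f ⟨A, hA⟩, (hmem _ _).2 ⟨hA, rfl⟩, fun j hj => ((hmem _ _).1 hj).2.symm⟩

/-! ### From Steiner triple systems to fall colorings -/

/-- The block spanned by a pair, for a Steiner operation. -/
def IsSteinerOp.block {V : Type*} [DecidableEq V] (op : V → V → V) (A : Finset V) : Finset V :=
  A ∪ A.offDiag.image fun p => op p.1 p.2

theorem IsSteinerOp.block_pair {V : Type*} [DecidableEq V] {op : V → V → V} (h : IsSteinerOp op)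
    {x y : V} (hxy : x ≠ y) : IsSteinerOp.block op {x, y} = {x, y, op x y} := by
  have := h.comm x y
  ext z
  simp only [IsSteinerOp.block, Finset.mem_union, Finset.mem_image, Finset.mem_offDiag,
    Finset.mem_insert, Finset.mem_singleton, Prod.exists]
  constructor
  · rintro (h1 | ⟨a, b, ⟨rfl | rfl, rfl | rfl, h2⟩, rfl⟩)
    · exact h1.imp_right .inl
    all_goals simp_all
  · rintro (h1 | h1 | rfl)
    · simp [h1]
    · simp [h1]
    · exact .inr ⟨x, y, by simp [hxy]⟩

theorem IsSteinerOp.card_block {V : Type*} [DecidableEq V] {op : V → V → V} (h : IsSteinerOp op)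
    {A : Finset V} (hA : A.card = 2) : (IsSteinerOp.block op A).card = 3 := by
  obtain ⟨x, y, hxy, rfl⟩ := Finset.card_eq_two.1 hA
  rw [h.block_pair hxy, Finset.card_eq_three]
  refine ⟨x, y, op x y, hxy, fun e => hxy ?_, fun e => hxy ?_, rfl⟩
  · rw [← h.cancel x y, ← e, h.idem]
  · have := h.cancel y x
    rw [h.comm y x, ← e, h.idem] at this
    exact this.symm

theorem IsSteinerOp.block_eq_of_subset {V : Type*} [DecidableEq V] {op : V → V → V}
    (h : IsSteinerOp op) {A B : Finset V} (hA : A.card = 2) (hB : B.card = 2)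
    (hBA : B ⊆ IsSteinerOp.block op A) :
    IsSteinerOp.block op B = IsSteinerOp.block op A := by
  refine Finset.eq_of_subset_of_card_le ?_ (by rw [h.card_block hA, h.card_block hB])
  obtain ⟨x, y, hxy, rfl⟩ := Finset.card_eq_two.1 hA
  obtain ⟨u, v, huv, rfl⟩ := Finset.card_eq_two.1 hB
  rw [h.block_pair hxy] at hBA ⊢
  rw [h.block_pair huv]
  have e1 := h.comm x y
  have e2 := h.cancel x y
  have e3 := h.cancel y x
  have e4 := h.comm (op x y) x
  have e5 := h.comm (op x y) y
  simp only [Finset.insert_subset_iff, Finset.singleton_subset_iff, Finset.mem_insert,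
    Finset.mem_singleton] at hBA ⊢
  refine ⟨hBA.1, hBA.2, ?_⟩
  obtain ⟨rfl | rfl | rfl, rfl | rfl | rfl⟩ := hBA <;> simp_all

/-- Allows colors in any type: only the values attained are kept, and `k` is their number. -/
theorem exists_mem_Fall_of_function {n : ℕ} (hn : 2 ≤ n) {α : Type*}
    (f : {A : Finset (Fin n) // A.card = 2} → α)
    (hproper : ∀ u v, Disjoint u.1 v.1 → f u ≠ f v)
    (hfall : ∀ v w, ∃ u, (u = v ∨ Disjoint v.1 u.1) ∧ f u = f w) :
    ∃ k, k ∈ Fall (kneserGraph n 2) := by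
  classical
  have : Nonempty {A : Finset (Fin n) // A.card = 2} :=
    ⟨⟨{(⟨0, by omega⟩ : Fin n), (⟨1, by omega⟩ : Fin n)}, Finset.card_pair (by simp)⟩⟩
  let e := Fintype.equivFin (Set.range f)
  refine ⟨Fintype.card (Set.range f), Fintype.card_pos,
    SimpleGraph.Coloring.mk (fun v => e ⟨f v, v, rfl⟩) ?_, ?_⟩
  · intro u v huv h
    exact hproper u v huv.2 (congrArg Subtype.val (e.injective h))
  · intro v
    refine Set.eq_univ_of_forall fun i => ?_
    obtain ⟨⟨c, w, rfl⟩, rfl⟩ := e.surjective i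
    obtain ⟨u, hu, hfu⟩ := hfall v w
    refine ⟨u, ?_, congrArg e (Subtype.ext hfu)⟩
    by_cases huv : u = v
    · exact .inl huv
    · exact .inr ⟨Ne.symm huv, hu.resolve_left huv⟩

/-- A Steiner triple system on all points, or on all points but one, gives a fall coloring. -/
theorem exists_mem_Fall_of_steinerOp {n : ℕ} (hn : 4 ≤ n) {V : Type*} [Fintype V] [DecidableEq V]
    {op : V → V → V} (h : IsSteinerOp op) (e : V ↪ Fin n) (hV : n ≤ Fintype.card V + 1) :
    ∃ k, k ∈ Fall (kneserGraph n 2) := by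
  classical
  have hout : ∀ a b : Fin n, a ∉ Set.range e → b ∉ Set.range e → a = b := by
    intro a b ha hb
    by_contra hab
    have h1 : (Finset.univ.map e).card + ({a, b} : Finset (Fin n)).card ≤ n := by
      rw [← Finset.card_union_of_disjoint]
      · simpa using Finset.card_le_univ (Finset.univ.map e ∪ {a, b})
      · rw [Finset.disjoint_left]
        intro x hx
        simp only [Finset.mem_map, Finset.mem_univ, true_and] at hx
        simp only [Finset.mem_insert, Finset.mem_singleton, not_or]
        exact ⟨by rintro rfl; exact ha hx, by rintro rfl; exact hb hx⟩
    rw [Finset.card_map, Finset.card_univ, Finset.card_pair hab] at h1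
    omega
  let r : Finset (Fin n) → Finset V := fun A => A.preimage e e.injective.injOn
  have hmap : ∀ A, (∀ a ∈ A, a ∈ Set.range e) → (r A).map e = A := by
    intro A hA
    ext a
    simp only [r, Finset.mem_map, Finset.mem_preimage]
    exact ⟨by rintro ⟨b, hb, rfl⟩; exact hb, fun ha => by
      obtain ⟨b, rfl⟩ := hA a ha; exact ⟨b, ha, rfl⟩⟩
  have hr : ∀ B : Finset V, r (B.map e) = B := by
    intro B; ext x; simp [r]
  -- The value `∅` serves as the star color; it is never a block, as blocks have three points.
  let f : {A : Finset (Fin n) // A.card = 2} → Finset V := fun A =>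
    if ∀ a ∈ A.1, a ∈ Set.range e then IsSteinerOp.block op (r A.1) else ∅
  have hf : ∀ B : Finset V, ∀ hB : (B.map e).card = 2,
      f ⟨B.map e, hB⟩ = IsSteinerOp.block op B := by
    intro B hB
    have : ∀ a ∈ B.map e, a ∈ Set.range e := by simp
    simp only [f, hr]
    rw [if_pos this]
  have hcases : ∀ A : {A : Finset (Fin n) // A.card = 2},
      (∃ B : Finset V, B.card = 2 ∧ A.1 = B.map e ∧ f A = IsSteinerOp.block op B) ∨
      (∃ a ∈ A.1, a ∉ Set.range e) ∧ f A = ∅ := by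
    intro A
    by_cases hA : ∀ a ∈ A.1, a ∈ Set.range e
    · refine .inl ⟨r A.1, ?_, (hmap _ hA).symm, if_pos hA⟩
      rw [← Finset.card_map e, hmap _ hA, A.2]
    · refine .inr ⟨by push Not at hA; exact hA, if_neg hA⟩
  refine exists_mem_Fall_of_function (by omega) f ?_ ?_
  · intro u v huv hfuv
    rcases hcases u with ⟨B, hB, huB, hfu⟩ | ⟨⟨a, ha, hae⟩, hfu⟩ <;>
      rcases hcases v with ⟨C, hC, hvC, hfv⟩ | ⟨⟨b, hb, hbe⟩, hfv⟩
    -- Two disjoint pairs would put four points in one block of size three.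
    · rw [huB, hvC, Finset.disjoint_map] at huv
      have h1 : B ∪ C ⊆ IsSteinerOp.block op B := by
        refine Finset.union_subset Finset.subset_union_left ?_
        rw [← hfu, hfuv, hfv]
        exact Finset.subset_union_left
      have h2 := Finset.card_le_card h1
      rw [Finset.card_union_of_disjoint huv, h.card_block hB] at h2
      omega
    · have h1 := h.card_block hB
      rw [← hfu, hfuv, hfv] at h1
      simp at h1
    · have h1 := h.card_block hC
      rw [← hfv, ← hfuv, hfu] at h1
      simp at h1
    · exact Finset.disjoint_left.1 huv ha (hout a b hae hbe ▸ hb)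
  · intro v w
    rcases hcases w with ⟨C, hC, hwC, hfw⟩ | ⟨⟨b, hb, hbe⟩, hfw⟩
    · rw [hfw]
      have hT := h.card_block hC
      set T := IsSteinerOp.block op C with hTdef
      by_cases hv : v.1 ⊆ T.map e
      · refine ⟨v, .inl rfl, ?_⟩
        have hvr : (r v.1).map e = v.1 := hmap _ fun a ha => by
          obtain ⟨b, -, rfl⟩ := Finset.mem_map.1 (hv ha); exact ⟨b, rfl⟩
        have hvr2 : (r v.1).card = 2 := by rw [← Finset.card_map e, hvr, v.2]
        have hfv : f v = IsSteinerOp.block op (r v.1) := by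
          rw [← hf _ (by rw [hvr, v.2])]
          exact congrArg f (Subtype.ext hvr.symm)
        rw [hfv]
        refine h.block_eq_of_subset hC hvr2 ?_
        rw [← Finset.map_subset_map (f := e), hvr]
        exact hv
      -- A pair not inside the block meets it in at most one point, leaving a pair of the block
      -- disjoint from `v`.
      · have h1 : (v.1 ∩ T.map e).card < 2 := by
          refine (Finset.card_lt_card ?_).trans_eq v.2
          refine ⟨Finset.inter_subset_left, fun hs => hv ?_⟩
          exact hs.trans Finset.inter_subset_right
        have h2 : 2 ≤ (T \ r v.1).card := by
          have h3 := Finset.card_sdiff_add_card_inter T (r v.1)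
          have h4 : (T ∩ r v.1).card ≤ (v.1 ∩ T.map e).card := by
            rw [← Finset.card_map e]
            refine Finset.card_le_card fun x hx => ?_
            obtain ⟨y, hy, rfl⟩ := Finset.mem_map.1 hx
            simp only [r, Finset.mem_inter, Finset.mem_preimage] at hy
            simp [hy]
          omega
        obtain ⟨B, hBs, hB⟩ := Finset.exists_subset_card_eq h2
        refine ⟨⟨B.map e, by rw [Finset.card_map, hB]⟩, .inr ?_, ?_⟩
        · rw [Finset.disjoint_left]
          intro x hx hxB
          obtain ⟨y, hy, rfl⟩ := Finset.mem_map.1 hxB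
          have := hBs hy
          simp only [r, Finset.mem_sdiff, Finset.mem_preimage] at this
          exact this.2 hx
        · rw [hf]
          exact h.block_eq_of_subset hC hB (hBs.trans Finset.sdiff_subset)
    · rw [hfw]
      have hstar : ∀ u : {A : Finset (Fin n) // A.card = 2}, b ∈ u.1 → f u = ∅ :=
        fun u hu => if_neg fun hall => hbe (hall b hu)
      by_cases hbv : b ∈ v.1
      · exact ⟨v, .inl rfl, hstar v hbv⟩
      -- A fourth point exists because `n ≥ 4`; then `{b, z}` has the star color and misses `v`.
      · obtain ⟨z, hz⟩ : ∃ z, z ∉ insert b v.1 := by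
          by_contra! hall
          have h1 := Finset.card_le_card
            (fun x _ => hall x : (Finset.univ : Finset (Fin n)) ⊆ insert b v.1)
          have h2 := Finset.card_insert_le b v.1
          rw [v.2] at h2
          rw [Finset.card_univ, Fintype.card_fin] at h1
          omega
        simp only [Finset.mem_insert, not_or] at hz
        refine ⟨⟨{b, z}, Finset.card_pair (Ne.symm hz.1)⟩, .inr ?_, hstar _ (by simp)⟩
        simp [hbv, hz.2]

/-! ### Existence for every admissible order, and the final cases -/

theorem exists_steinerOp (m : ℕ) (hm : m % 6 = 1 ∨ m % 6 = 3) (hm1 : m ≠ 1) :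
    ∃ (V : Type) (_ : Fintype V) (_ : DecidableEq V) (op : V → V → V),
      IsSteinerOp op ∧ Fintype.card V = m := by
  rcases hm with hm | hm
  · obtain ⟨op, hop⟩ := exists_steinerOp_skolem (m / 6) (by omega)
    refine ⟨_, inferInstance, inferInstance, op, hop, ?_⟩
    simp only [Fintype.card_option, Fintype.card_prod, Fintype.card_fin, ZMod.card]
    omega
  · obtain ⟨op, hop⟩ := exists_steinerOp_bose (m / 6)
    refine ⟨_, inferInstance, inferInstance, op, hop, ?_⟩
    simp only [Fintype.card_prod, ZMod.card]
    omega

theorem Fall_nonempty {n : ℕ} (hn : 4 ≤ n)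
    (h6 : n % 6 = 1 ∨ n % 6 = 3 ∨ n % 6 = 2 ∨ n % 6 = 4) :
    ∃ k, k ∈ Fall (kneserGraph n 2) := by
  -- For odd `n` the system uses all points; for even `n` one point is left out as the centre of the
  -- star.
  obtain ⟨m, hm, hm1, hmn, hnm⟩ : ∃ m, (m % 6 = 1 ∨ m % 6 = 3) ∧ m ≠ 1 ∧ m ≤ n ∧ n ≤ m + 1 := by
    by_cases h : n % 2 = 1
    · exact ⟨n, by omega⟩
    · exact ⟨n - 1, by omega⟩
  obtain ⟨V, _, _, op, hop, hV⟩ := exists_steinerOp m hm hm1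
  obtain ⟨e⟩ : Nonempty (V ↪ Fin n) :=
    Function.Embedding.nonempty_of_card_le (by rw [hV, Fintype.card_fin]; exact hmn)
  exact exists_mem_Fall_of_steinerOp hn hop e (by omega)

theorem Fall_eq_one {n : ℕ} (hn : 2 ≤ n) (hn3 : n ≤ 3) : Fall (kneserGraph n 2) = {1} := by
  have hnd : ∀ u v : {A : Finset (Fin n) // A.card = 2}, ¬ Disjoint u.1 v.1 := by
    intro u v huv
    have h1 := Finset.card_le_univ (u.1 ∪ v.1)
    rw [Finset.card_union_of_disjoint huv, u.2, v.2, Fintype.card_fin] at h1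
    omega
  let v : {A : Finset (Fin n) // A.card = 2} :=
    ⟨{(⟨0, by omega⟩ : Fin n), (⟨1, by omega⟩ : Fin n)}, Finset.card_pair (by simp)⟩
  have huniq : ∀ k ∈ Fall (kneserGraph n 2), k = 1 := by
    rintro k ⟨hk, f, hf⟩
    -- The graph has no edges, so every color must be that of `v` itself.
    have hall : ∀ i, f v = i := by
      intro i
      have : i ∈ f '' closedNeighborSet (kneserGraph n 2) v := by rw [hf v]; trivial
      obtain ⟨u, rfl | hu, hi⟩ := this
      · exact hi
      · exact absurd hu.2 (hnd _ _)
    have : Subsingleton (Fin k) := ⟨fun i j => (hall i).symm.trans (hall j)⟩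
    have := Fin.subsingleton_iff_le_one.1 this
    omega
  obtain ⟨k, hk⟩ := exists_mem_Fall_of_function hn
    (fun _ : {A : Finset (Fin n) // A.card = 2} => ()) (fun u v h => absurd h (hnd u v))
    (fun v _ => ⟨v, .inl rfl, rfl⟩)
  exact Set.eq_singleton_iff_unique_mem.2 ⟨huniq k hk ▸ hk, huniq⟩

theorem mainTheorem1 (n : ℕ) (hn : 2 ≤ n) :
    ((n = 2 ∨ n = 3) → Fall (kneserGraph n 2) = {1}) ∧
    (n = 4 → Fall (kneserGraph n 2) = {2}) ∧
    (5 ≤ n → (n % 6 = 1 ∨ n % 6 = 3) →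
      Fall (kneserGraph n 2) = {n * (n - 1) / 6}) ∧
    (5 ≤ n → (n % 6 = 2 ∨ n % 6 = 4) →
      Fall (kneserGraph n 2) = {(n - 1) * (n - 2) / 6 + 1}) ∧
    (5 ≤ n → (n % 6 = 0 ∨ n % 6 = 5) →
      Fall (kneserGraph n 2) = ∅) := by
  have hsing : ∀ c, (∃ k, k ∈ Fall (kneserGraph n 2)) →
      (∀ k ∈ Fall (kneserGraph n 2), k = c) → Fall (kneserGraph n 2) = {c} := by
    rintro c ⟨k, hk⟩ h
    exact Set.eq_singleton_iff_unique_mem.2 ⟨h k hk ▸ hk, h⟩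
  refine ⟨fun h => Fall_eq_one hn (by omega), fun h => ?_, fun h5 h => ?_, fun h5 h => ?_,
    fun h5 h => ?_⟩
  -- The general count already covers `n = 4`: one star and the triangle opposite it, `3 * 2 / 6 + 1
  -- = 2`.
  · subst h
    refine hsing _ (Fall_nonempty le_rfl (by omega)) fun k hk => ?_
    have := mod_six_of_mem_Fall le_rfl hk
    omega
  · refine hsing _ (Fall_nonempty (by omega) (by omega)) fun k hk => ?_
    rcases mod_six_of_mem_Fall (by omega) hk with ⟨-, h2⟩ | ⟨h1, -⟩
    · exact h2
    · omega
  · refine hsing _ (Fall_nonempty (by omega) (by omega)) fun k hk => ?_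
    rcases mod_six_of_mem_Fall (by omega) hk with ⟨h1, -⟩ | ⟨-, h2⟩
    · omega
    · exact h2
  · refine Set.eq_empty_of_forall_notMem fun k hk => ?_
    rcases mod_six_of_mem_Fall (by omega) hk with ⟨h1, -⟩ | ⟨h1, -⟩ <;> omega
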